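/- **Setting.** Fix $k\ge 0$. A network $N$ with a finite set of cells $C$ and $k$ edge types is given by functions $\sigma_1,\dots,\sigma_k:C\to C$, where $\sigma_i(c)$ is the source of the unique edge of type $i$ with target $c$; networks are identified up to relabelling of cells. It is a feed-forward network with layers $C_0,\dots,C_m$ if these nonempty sets partition $C$, $\sigma_i(c)=c$ for $c\in C_0$, $\sigma_i(C_j)\subseteq C_{j-1}$ for $1\le j\le m$, every cell of $C_j$ with $j<m$ equals $\sigma_i(c')$ for some $i$ and some $c'\in C_{j+1}$, and the underlying undirected graph is connected. A coloring (equivalence relation on the cells) $\bowtie$ is balanced if $c\bowtie c'$ implies $\sigma_i(c)\bowtie\sigma_i(c')$ for all $i$; it then induces the quotient network $N/\!\bowtie$ on the classes. A network $L$ is the split of a cell $c$ of $N$ into two distinct cells $c_1,c_2$ of $L$ if the coloring of $L$ whose only nontrivial class is $\{c_1,c_2\}$ is balanced with quotient $N$, the class $\{c_1,c_2\}$ corresponding to $c$. Let $\mathcal V_0$ be the set of smooth $f:\mathbb R\times\mathbb R^k\times\mathbb R\to\mathbb R$, $(x_0,x_1,\dots,x_k,\lambda)\mapsto f$, with $f(0,\dots,0,\lambda)=0$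 for all $\lambda$ and $\partial f/\partial x_0(0)=0$. Write $f_i=\partial f/\partial x_i(0)$. The vector field of $f$ on $L$ is $(f^L(x,\lambda))_a=f(x_a,x_{\sigma^L_1(a)},\dots,x_{\sigma^L_k(a)},\lambda)$. A subset of $\mathcal V_0$ is called generic if it is open in $\mathcal V_0$ for the weak $C^\infty$ topology and dense in $\mathcal V_0$ for the strong (Whitney) $C^\infty$ topology; it is then open and dense for both. An equilibrium branch of $f$ on $L$ is (the germ at $\lambda=0$ of) a continuous function $b$ with values in $\mathbb R^{|L|}$, defined on a domain $D$ of the form $]-\lambda_0,0]$, $]-\lambda_0,\lambda_0[$ or $[0,\lambda_0[$ with $\lambda_0>0$, such that $b(0)=0$ and $f^L(b(\lambda),\lambda)=0$ for all $\lambda\in D$. It is a bifurcation branch if it is not identically $0$ in any neighbourhood of $0$ in $D$. It is lifted from $N$ if there is a balanced coloring $\bowtie$ of $L$ with $L/\!\bowtie\,=N$ such that, for all $\lambda\in D$ close enough to $0$, $b_a(\lambda)=b_{a'}(\lambda)$ whenever $a\bowtie a'$. **Proposition.** For every $k$ there is a generic set $\mathcal G\subseteq\mathcal V_0$ such that the following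 holds for every $f\in\mathcal G$. Let $N$ and $L$ be feed-forward networks with $k$ edge types, with layers $C_0,\dots,C_m$ and $C'_0,\dots,C'_n$ respectively, such that $L$ is the split of a cell $c\in C_1$ into two cells $c_1,c_2\in C'_1$. For a cell $d$ of $L$ and a set $I$ of cells of $L$ put $$w_I^d=\sum_{i:\ \sigma_i^L(d)\in I} f_i,\qquad w_1^d=\sum_{i:\ \sigma_i^L(d)=c_1} f_i,\qquad w_2^d=\sum_{i:\ \sigma_i^L(d)=c_2} f_i .$$ Suppose that for every $I\subseteq C'_1\setminus\{c_1,c_2\}$ there exist $d',d''$ in the third layer $C'_2$ of $L$ (which is identified with the third layer $C_2$ of $N$) such that $$(w_I^{d'}+w_1^{d'})(w_I^{d''}+w_1^{d''})<0\quad\text{and}\quad (w_I^{d'}+w_2^{d'})(w_I^{d''}+w_2^{d''})<0 .$$ Then every bifurcation branch of $f$ on $L$ is lifted from $N$. -/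

import Mathlib

open Set Filter Topology
open scoped ContDiff

namespace FFN

universe u v

/-! ### Networks, feed-forward networks, quotients and splits -/

/-- A network with cell set `C` and `k` edge types, each cell being the target of exactly one edge
of each type: `src i c` is the source of the edge of type `i` targeting `c`. -/
structure Network (k : ℕ) (C : Type u) where
  src : Fin k → C → C

variable {k : ℕ} {C : Type u} {C' : Type v}

/-- Equality of networks up to a relabelling of the cells. -/
def Network.Same (N : Network k C) (N' : Network k C') : Prop :=
  ∃ φ : C ≃ C', ∀ i c, φ (N.src i c) = N'.src i (φ c)

/-- `N` is a (connected) feed-forward network with layers `C_j = {c | layer c = j}`,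
`0 ≤ j ≤ m`. -/
structure Network.IsFeedForward (N : Network k C) (m : ℕ) (layer : C → ℕ) : Prop where
  /-- The (nonempty) parts of the partition are exactly `C_0, …, C_m`. -/
  parts : ∀ j, (∃ c, layer c = j) ↔ j ≤ m
  /-- Every cell of `C_0` is its own source, for every edge type. -/
  first : ∀ c, layer c = 0 → ∀ i, N.src i c = c
  /-- The sources of the cells of `C_{j+1}` lie in `C_j`. -/
  step : ∀ c j, layer c = j + 1 → ∀ i, layer (N.src i c) = j
  /-- Every cell outside the last layer is a source of a cell of the next layer. -/
  isSource : ∀ c, layer c < m → ∃ c' i, layer c' = layer c + 1 ∧ N.src i c' = c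
  /-- Any two cells are joined by an undirected path. -/
  connected : ∀ c c', Relation.EqvGen (fun a b => ∃ i, N.src i b = a) c c'

/-- A coloring (an equivalence relation on the cells) is balanced if sources of equally colored
cells, for the same edge type, are equally colored. -/
def Network.Balanced (N : Network k C) (r : Setoid C) : Prop :=
  ∀ i c c', r c c' → r (N.src i c) (N.src i c')

/-- The quotient network of `N` by a balanced coloring. -/
def Network.quotient (N : Network k C) (r : Setoid C) (h : N.Balanced r) :
    Network k (Quotient r) where
  src i := Quotient.map (N.src i) (fun c c' hc => h i c c' hc)

/-- The coloring whose only class with possibly more than one element is `{c₁, c₂}`. -/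
def pairColoring (c₁ c₂ : C) : Setoid C where
  r a b := a = b ∨ (a = c₁ ∨ a = c₂) ∧ (b = c₁ ∨ b = c₂)
  iseqv :=
    { refl := fun _ => Or.inl rfl
      symm := by
        rintro a b (h | ⟨h, h'⟩)
        · exact Or.inl h.symm
        · exact Or.inr ⟨h', h⟩
      trans := by
        rintro a b c (rfl | ⟨h, h'⟩) hbc
        · exact hbc
        · rcases hbc with rfl | ⟨_, h₃⟩
          · exact Or.inr ⟨h, h'⟩
          · exact Or.inr ⟨h, h₃⟩ }

/-- `L` is the split of the cell `c` of `N` into the two cells `c₁`, `c₂`: the coloring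
`c₁ ⋈ c₂` of `L` is balanced, and the quotient of `L` by it is `N`, the class of `c₁` and `c₂`
being `c`. -/
def Network.IsSplit (N : Network k C) (L : Network k C') (c : C) (c₁ c₂ : C') : Prop :=
  c₁ ≠ c₂ ∧ ∃ h : L.Balanced (pairColoring c₁ c₂),
    ∃ φ : Quotient (pairColoring c₁ c₂) ≃ C,
      (∀ i q, φ ((L.quotient _ h).src i q) = N.src i (φ q)) ∧
      φ (Quotient.mk _ c₁) = c ∧ φ (Quotient.mk _ c₂) = c

/-! ### Families of functions with an internal-dynamics bifurcation condition -/

/-- The variables `(x₀, (x₁, …, x_k), λ)`. -/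
abbrev Vars (k : ℕ) : Type := ℝ × (Fin k → ℝ) × ℝ

/-- The smooth families `f` with `f(0, 0, …, 0, λ) = 0` for every `λ`. -/
def V (k : ℕ) : Set (Vars k → ℝ) :=
  {f | ContDiff ℝ ∞ f ∧ ∀ t : ℝ, f (0, 0, t) = 0}

/-- The partial derivative `f_0 = ∂f/∂x₀` at the origin. -/
noncomputable def internalDeriv (f : Vars k → ℝ) : ℝ := fderiv ℝ f 0 (1, 0, 0)

/-- The partial derivatives `f_i = ∂f/∂x_i`, `1 ≤ i ≤ k`, at the origin. -/
noncomputable def inputDeriv (f : Vars k → ℝ) (i : Fin k) : ℝ :=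
  fderiv ℝ f 0 (0, Pi.single i 1, 0)

/-- The families with a bifurcation condition associated with the internal dynamics. -/
def V0 (k : ℕ) : Set (Vars k → ℝ) := {f | f ∈ V k ∧ internalDeriv f = 0}

/-- `G` is a generic subset of the set `S` of smooth functions: it is open in `S` for the
topology of uniform convergence of derivatives up to finite order on compact sets (the weak
`C^∞` topology), and dense in `S` for the strong Whitney `C^∞` topology. As the
strong topology is finer, `G` is then open and dense in `S` for both topologies. -/
def IsGeneric {E : Type*} [NormedAddCommGroup E] [NormedSpace ℝ E] (S G : Set (E → ℝ)) : Prop :=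
  G ⊆ S ∧
  (∀ f ∈ G, ∃ K : Set E, IsCompact K ∧ ∃ r : ℕ, ∃ ε > (0 : ℝ), ∀ g ∈ S,
    (∀ x ∈ K, ∀ j ≤ r, ‖iteratedFDeriv ℝ j g x - iteratedFDeriv ℝ j f x‖ < ε) → g ∈ G) ∧
  (∀ f ∈ S, ∀ r : ℕ, ∀ ε : E → ℝ, Continuous ε → (∀ x, 0 < ε x) → ∃ g ∈ G,
    ∀ x, ∀ j ≤ r, ‖iteratedFDeriv ℝ j g x - iteratedFDeriv ℝ j f x‖ < ε x)

/-! ### Feed-forward systems and their branches -/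

/-- The admissible vector field `f^N` (with parameter). -/
def Network.field (N : Network k C) (f : Vars k → ℝ) (x : C → ℝ) (t : ℝ) : C → ℝ :=
  fun c => f (x c, fun i => x (N.src i c), t)

/-- The domains of branches: `]-l, 0]`, `]-l, l[` and `[0, l[` with `l > 0`. -/
def IsBranchDomain (D : Set ℝ) : Prop :=
  ∃ l : ℝ, 0 < l ∧ (D = Ioc (-l) 0 ∨ D = Ioo (-l) l ∨ D = Ico 0 l)

/-- `b : D → ℝ^C` is (a representative of) an equilibrium branch of `f` on `N` at the bifurcation
point `(0, 0)`. Since branches behave like `|λ|^{2^{-p}}` at `λ = 0`, only continuity is asked. -/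
structure Network.IsEquilibriumBranch (N : Network k C) (f : Vars k → ℝ) (D : Set ℝ)
    (b : ℝ → C → ℝ) : Prop where
  domain : IsBranchDomain D
  cont : ContinuousOn b D
  zero : b 0 = 0
  equilibrium : ∀ t ∈ D, N.field f (b t) t = 0

/-- A bifurcation branch is an equilibrium branch whose germ is not the trivial one. -/
def Network.IsBifurcationBranch (N : Network k C) (f : Vars k → ℝ) (D : Set ℝ)
    (b : ℝ → C → ℝ) : Prop :=
  N.IsEquilibriumBranch f D b ∧ ¬ ∀ᶠ t in 𝓝[D] 0, b t = 0

/-- The polydiagonal subspace of a coloring. -/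
def polydiagonal (r : Setoid C) : Set (C → ℝ) := {x | ∀ c d, r c d → x c = x d}

/-- The branch `b : D → ℝ^{C'}` on `L` is lifted from `N`: as a germ, it takes values in the
polydiagonal of a balanced coloring of `L` with quotient network `N`. -/
def IsLiftedFrom (N : Network k C) (L : Network k C') (D : Set ℝ) (b : ℝ → C' → ℝ) : Prop :=
  ∃ (r : Setoid C') (h : L.Balanced r), (L.quotient r h).Same N ∧
    ∀ᶠ t in 𝓝[D] 0, b t ∈ polydiagonal r

open Classical in
/-- The sum of `f_i` over the edge types `i` for which the source of the edge of type `i`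
targeting `d` lies in `S`. -/
noncomputable def Network.weight (L : Network k C) (f : Vars k → ℝ) (d : C) (S : Set C) : ℝ :=
  ∑ i with L.src i d ∈ S, inputDeriv f i

end FFN

namespace FFN

/-! Write A = `internalDeriv₂ f` and B = `mixedDeriv f`. Generically A, B and, when k > 0, the sum
of the f_i are nonzero; no condition depends on the networks. At a small equilibrium with parameter
t ≠ 0, cells of the first layer vanish because the f_i have nonzero sum. A cell of the second layer
then solves f(x, 0, t) = 0, so it is 0 or the only other small root β, where β ≈ -2Bt/A
(`exists_radius_unique`). A cell d of the third layer with value z, whose inputs equal to β have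
total weight w, satisfies A z²/2 + B t z + w β ≈ 0. To leading order A² z² = 4wBt, which forces wBt
≥ 0 (`exists_radius_sign`). If the values at c₁ and c₂ differ, one is β and the other 0. Take for I
the remaining nonzero cells of the second layer: the hypothesis yields d' and d'' whose weights w
have opposite signs, a contradiction (`exists_radius_no_switch`). The argument works at each t
separately, so I may vary with t along a branch. The two halves thus agree for all small t, and the
coloring c₁ ⋈ c₂ provides the lift. -/

/-- The second derivative `∂²f/∂x₀²` at the origin. -/
noncomputable def internalDeriv₂ {k : ℕ} (f : Vars k → ℝ) : ℝ :=
  fderiv ℝ (fderiv ℝ f) 0 (1, 0, 0) (1, 0, 0)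

/-- The mixed second derivative `∂²f/∂λ∂x₀` at the origin. -/
noncomputable def mixedDeriv {k : ℕ} (f : Vars k → ℝ) : ℝ :=
  fderiv ℝ (fderiv ℝ f) 0 (0, 0, 1) (1, 0, 0)

/-- The sum of the partial derivatives of `f` with respect to its inputs, at the origin. -/
noncomputable def inputSum {k : ℕ} (f : Vars k → ℝ) : ℝ := fderiv ℝ f 0 (0, 1, 0)

/-- The families satisfying the nondegeneracy conditions used below. -/
def nondegenerate (k : ℕ) : Set (Vars k → ℝ) :=
  {f | f ∈ V0 k ∧ internalDeriv₂ f ≠ 0 ∧ mixedDeriv f ≠ 0 ∧ (k ≠ 0 → inputSum f ≠ 0)}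

/-! ### Local analysis of f near the origin -/

section LocalAnalysis

variable {k : ℕ} {f : Vars k → ℝ}

lemma contDiff_fderiv (hf : ContDiff ℝ ∞ f) : ContDiff ℝ ∞ (fderiv ℝ f) :=
  hf.fderiv_right (by simp)

lemma hasStrictFDerivAt_zero (hf : ContDiff ℝ ∞ f) : HasStrictFDerivAt f (fderiv ℝ f 0) 0 :=
  hf.contDiffAt.hasStrictFDerivAt (by simp)

lemma hasStrictFDerivAt_fderiv_zero (hf : ContDiff ℝ ∞ f) :
    HasStrictFDerivAt (fderiv ℝ f) (fderiv ℝ (fderiv ℝ f) 0) 0 :=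
  (contDiff_fderiv hf).contDiffAt.hasStrictFDerivAt (by simp)

lemma exists_strict_bound {E F : Type*} [NormedAddCommGroup E] [NormedSpace ℝ E]
    [NormedAddCommGroup F] [NormedSpace ℝ F] {g : E → F} {g' : E →L[ℝ] F}
    (hg : HasStrictFDerivAt g g' 0) {ε : ℝ} (hε : 0 < ε) :
    ∃ δ > 0, ∀ p q : E, ‖p‖ < δ → ‖q‖ < δ → ‖g p - g q - g' (p - q)‖ ≤ ε * ‖p - q‖ := by
  have h := hg.isLittleO.def hε
  rw [Metric.eventually_nhds_iff] at h
  obtain ⟨δ, hδ, h⟩ := h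
  refine ⟨δ, hδ, fun p q hp hq => h (y := (p, q)) ?_⟩
  simp [Prod.dist_eq, hp, hq]

lemma norm_internal (x : ℝ) (y : Fin k → ℝ) (t δ : ℝ) (hx : |x| < δ) (hy : ∀ i, |y i| < δ)
    (ht : |t| < δ) : ‖((x, y, t) : Vars k)‖ < δ := by
  have hδ : 0 < δ := (abs_nonneg x).trans_lt hx
  simp only [Prod.norm_def, Real.norm_eq_abs, sup_lt_iff]
  exact ⟨hx, (pi_norm_lt_iff hδ).2 hy, ht⟩

lemma hasDerivAt_internal (hf : ContDiff ℝ ∞ f) (t s : ℝ) :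
    HasDerivAt (fun x => f (x, 0, t)) (fderiv ℝ f (s, 0, t) (1, 0, 0)) s := by
  have h1 : HasDerivAt (fun x : ℝ => ((x, 0, t) : Vars k)) (1, 0, 0) s :=
    (hasDerivAt_id s).prodMk (hasDerivAt_const s (0, t))
  have h2 : HasFDerivAt f (fderiv ℝ f (s, 0, t)) (s, 0, t) :=
    (hf.differentiable (by simp) _).hasFDerivAt
  exact h2.comp_hasDerivAt s h1

/-- Cells that are their own sources are at rest. -/
lemma exists_radius_self_input (hf : f ∈ nondegenerate k) (hk : k ≠ 0) :
    ∃ δ > 0, ∀ x t : ℝ, |x| < δ → |t| < δ → f (x, fun _ => x, t) = 0 → x = 0 := by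
  obtain ⟨⟨⟨hs, hz⟩, h0⟩, -, -, hS⟩ := hf
  have hS := abs_pos.2 (hS hk)
  obtain ⟨δ, hδ, h⟩ := exists_strict_bound (hasStrictFDerivAt_zero hs) (half_pos hS)
  refine ⟨δ, hδ, fun x t hx ht hxt => ?_⟩
  have h := h (x, fun _ => x, t) (0, 0, t) (norm_internal _ _ _ _ hx (fun _ => hx) ht)
    (norm_internal _ _ _ _ (by simpa) (fun _ => by simpa using hδ) ht)
  -- Comparing with the trivial zero at the same parameter leaves the direction (1, (1, …, 1), 0),
  -- where the derivative is `inputSum f` since f_0 = 0.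
  have e : ((x, fun _ => x, t) : Vars k) - (0, 0, t) = x • ((1, 0, 0) + (0, 1, 0)) := by
    ext <;> simp
  have hn : ‖((1, 0, 0) + (0, 1, 0) : Vars k)‖ ≤ 1 := by
    simp only [Prod.mk_add_mk, Prod.norm_def]
    simp only [add_zero, zero_add, norm_one, norm_zero, sup_le_iff, le_refl, true_and, zero_le_one,
      and_true]
    exact (pi_norm_le_iff_of_nonneg zero_le_one).2 (by simp)
  rw [hxt, hz, e, map_smul, map_add, norm_smul] at h
  change fderiv ℝ f 0 (1, 0, 0) = 0 at h0
  change _ ≤ |inputSum f| / 2 * _ at h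
  rw [h0] at h
  change ‖0 - 0 - x • (0 + inputSum f)‖ ≤ _ at h
  simp only [sub_zero, zero_add, zero_sub, norm_neg, smul_eq_mul, norm_mul, Real.norm_eq_abs] at h
  by_contra hx0
  have := abs_pos.2 hx0
  nlinarith [mul_le_mul_of_nonneg_left hn (mul_nonneg hS.le this.le), mul_pos hS this]

lemma fderiv_fderiv_internal (x t : ℝ) :
    fderiv ℝ (fderiv ℝ f) 0 (x, 0, t) (1, 0, 0) = internalDeriv₂ f * x + mixedDeriv f * t := by
  have e : ((x, 0, t) : Vars k) = x • (1, 0, 0) + t • (0, 0, 1) := by ext <;> simp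
  rw [e, map_add, map_smul, map_smul]
  simp [internalDeriv₂, mixedDeriv, mul_comm]

lemma norm_internal_le (x t : ℝ) : ‖((x, 0, t) : Vars k)‖ ≤ |x| + |t| := by
  simp [Prod.norm_def]

lemma norm_internal_unit : ‖((1, 0, 0) : Vars k)‖ ≤ 1 := by simp [Prod.norm_def]

/-- Strict differentiability of the derivative at 0 allows both points to move: one use compares
with the origin, another compares two critical points at the same parameter. -/
lemma exists_internalDeriv_bound (hf : ContDiff ℝ ∞ f) {ε : ℝ} (hε : 0 < ε) :
    ∃ δ > 0, ∀ x x' t t' : ℝ, |x| < δ → |x'| < δ → |t| < δ → |t'| < δ →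
      |fderiv ℝ f (x, 0, t) (1, 0, 0) - fderiv ℝ f (x', 0, t') (1, 0, 0)
        - (internalDeriv₂ f * (x - x') + mixedDeriv f * (t - t'))| ≤
      ε * (|x - x'| + |t - t'|) := by
  obtain ⟨δ, hδ, h⟩ := exists_strict_bound (hasStrictFDerivAt_fderiv_zero hf) hε
  refine ⟨δ, hδ, fun x x' t t' hx hx' ht ht' => ?_⟩
  have h := h (x, 0, t) (x', 0, t') (norm_internal _ _ _ _ hx (fun _ => by simpa using hδ) ht)
    (norm_internal _ _ _ _ hx' (fun _ => by simpa using hδ) ht')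
  have e : ((x, 0, t) : Vars k) - (x', 0, t') = (x - x', 0, t - t') := by simp
  rw [e] at h
  rw [← fderiv_fderiv_internal, ← Real.norm_eq_abs]
  calc _ ≤ ‖fderiv ℝ f (x, 0, t) - fderiv ℝ f (x', 0, t')
        - fderiv ℝ (fderiv ℝ f) 0 (x - x', 0, t - t')‖ * ‖((1, 0, 0) : Vars k)‖ :=
        ContinuousLinearMap.le_opNorm (fderiv ℝ f (x, 0, t) - fderiv ℝ f (x', 0, t')
          - fderiv ℝ (fderiv ℝ f) 0 (x - x', 0, t - t')) (1, 0, 0)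
    _ ≤ _ := mul_le_of_le_one_right (norm_nonneg _) norm_internal_unit
    _ ≤ _ := h.trans (by gcongr; exact norm_internal_le _ _)

/-- Second order expansion of `f` on the axes without inputs. -/
lemma exists_quadratic_bound (hf : f ∈ V0 k) {ε : ℝ} (hε : 0 < ε) :
    ∃ δ > 0, ∀ x t : ℝ, |x| < δ → |t| < δ →
      |f (x, 0, t) - (internalDeriv₂ f / 2 * x ^ 2 + mixedDeriv f * t * x)| ≤
        ε * (|x| + |t|) * |x| := by
  obtain ⟨⟨hs, hz⟩, h0⟩ := hf
  change fderiv ℝ f 0 (1, 0, 0) = 0 at h0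
  obtain ⟨δ, hδ, h⟩ := exists_internalDeriv_bound hs hε
  refine ⟨δ, hδ, fun x t hx ht => ?_⟩
  have hd : ∀ s, HasDerivAt
      (fun s => f (s, 0, t) - (internalDeriv₂ f / 2 * s ^ 2 + mixedDeriv f * t * s))
      (fderiv ℝ f (s, 0, t) (1, 0, 0) - (internalDeriv₂ f * s + mixedDeriv f * t)) s := by
    intro s
    refine (hasDerivAt_internal hs t s).sub ?_
    refine (((hasDerivAt_pow 2 s).const_mul (internalDeriv₂ f / 2)).add
      ((hasDerivAt_id s).const_mul (mixedDeriv f * t))).congr_deriv ?_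
    simp only [Nat.cast_ofNat, Nat.add_one_sub_one, pow_one]
    ring
  -- The mean value inequality from 0 to x supplies the factor |x|; the remainder vanishes at 0.
  have key := (convex_uIcc (0 : ℝ) x).norm_image_sub_le_of_norm_hasDerivWithin_le
    (C := ε * (|x| + |t|)) (fun s _ => (hd s).hasDerivWithinAt) (fun s hs' => ?_)
    left_mem_uIcc right_mem_uIcc
  · simpa [hz] using key
  · have hsx : |s| ≤ |x| := by simpa using abs_sub_left_of_mem_uIcc hs'
    have := h s 0 t 0 (hsx.trans_lt hx) (by simpa) ht (by simpa)
    have e : ((0, 0, 0) : Vars k) = 0 := rfl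
    rw [e, h0] at this
    simp only [sub_zero] at this
    exact this.trans (by gcongr)

/-- At fixed parameter, there is at most one nonzero small equilibrium without inputs. -/
lemma exists_radius_unique (hf : f ∈ nondegenerate k) :
    ∃ δ > 0, ∀ x x' t : ℝ, |x| < δ → |x'| < δ → |t| < δ → f (x, 0, t) = 0 → f (x', 0, t) = 0 →
      x ≠ 0 → x' ≠ 0 → x = x' := by
  obtain ⟨⟨⟨hs, hz⟩, h0⟩, hA, -, -⟩ := hf
  obtain ⟨δ, hδ, h⟩ := exists_internalDeriv_bound hs (half_pos (abs_pos.2 hA))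
  -- By Rolle, three roots give two distinct zeros of ∂f/∂x₀(·, 0, t), which is injective near 0
  -- because A ≠ 0. Since 0 is always a root, two distinct nonzero roots would make three.
  have three : ∀ a b c t : ℝ, |a| < δ → |b| < δ → |c| < δ → |t| < δ → a < b → b < c →
      f (a, 0, t) = 0 → f (b, 0, t) = 0 → f (c, 0, t) = 0 → False := by
    intro a b c t ha hb hc ht hab hbc fa fb fc
    have hcont : Continuous (fun x => f (x, 0, t)) :=
      continuous_iff_continuousAt.2 fun s => (hasDerivAt_internal hs t s).continuousAt
    obtain ⟨u, hu, hu'⟩ := exists_hasDerivAt_eq_zero hab hcont.continuousOn (fa.trans fb.symm)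
      (fun s _ => hasDerivAt_internal hs t s)
    obtain ⟨v, hv, hv'⟩ := exists_hasDerivAt_eq_zero hbc hcont.continuousOn (fb.trans fc.symm)
      (fun s _ => hasDerivAt_internal hs t s)
    rw [abs_lt] at ha hb hc
    have := h u v t t (abs_lt.2 ⟨by linarith [hu.1], by linarith [hu.2]⟩)
      (abs_lt.2 ⟨by linarith [hv.1], by linarith [hv.2]⟩) ht ht
    rw [hu', hv'] at this
    simp only [sub_self, mul_zero, add_zero, zero_sub, abs_neg, abs_mul, abs_zero] at this
    have huv : 0 < |u - v| := abs_pos.2 (by linarith [hu.2, hv.1])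
    nlinarith [mul_pos (abs_pos.2 hA) huv]
  refine ⟨δ, hδ, fun x x' t hx hx' ht fx fx' hx0 hx0' => ?_⟩
  have hO : |(0 : ℝ)| < δ := by simpa
  have f0 := hz t
  rcases lt_trichotomy x x' with h1 | h1 | h1
  · rcases lt_or_gt_of_ne hx0 with h2 | h2 <;> rcases lt_or_gt_of_ne hx0' with h3 | h3
    · exact (three x x' 0 t hx hx' hO ht h1 h3 fx fx' f0).elim
    · exact (three x 0 x' t hx hO hx' ht h2 h3 fx f0 fx').elim
    · linarith
    · exact (three 0 x x' t hO hx hx' ht h2 h1 f0 fx fx').elim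
  · exact h1
  · rcases lt_or_gt_of_ne hx0 with h2 | h2 <;> rcases lt_or_gt_of_ne hx0' with h3 | h3
    · exact (three x' x 0 t hx' hx hO ht h1 h2 fx' fx f0).elim
    · linarith
    · exact (three x' 0 x t hx' hO hx ht h3 h2 fx' f0 fx).elim
    · exact (three 0 x' x t hO hx' hx ht h3 h1 f0 fx' fx).elim

lemma fderiv_inputs (y : Fin k → ℝ) :
    fderiv ℝ f 0 (0, y, 0) = ∑ i, inputDeriv f i * y i := by
  have e : ((0, y, 0) : Vars k) = ∑ i, y i • ((0, Pi.single i 1, 0) : Vars k) := by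
    ext j
    · simp [Prod.fst_sum]
    · simp [Prod.snd_sum, Prod.fst_sum, Finset.sum_apply, Pi.single_apply]
    · simp [Prod.snd_sum]
  rw [e, map_sum]
  simp only [map_smul, inputDeriv, smul_eq_mul, mul_comm]

/-- If the inputs of a cell are either zero or the nonzero equilibrium without inputs, then the
total weight of the nonzero inputs determines on which side of the bifurcation the cell may be at
equilibrium. -/
lemma exists_radius_sign (hf : f ∈ nondegenerate k) (S : Finset (Fin k)) :
    ∃ δ > 0, ∀ z β t : ℝ, |z| < δ → |β| < δ → |t| < δ → β ≠ 0 → f (β, 0, t) = 0 →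
      f (z, fun i => if i ∈ S then β else 0, t) = 0 →
      0 ≤ (∑ i ∈ S, inputDeriv f i) * mixedDeriv f * t := by
  obtain ⟨hV, hA, hB, -⟩ := hf
  set A := internalDeriv₂ f with hAd
  set B := mixedDeriv f with hBd
  set w := ∑ i ∈ S, inputDeriv f i with hwd
  by_cases hw : w = 0
  · exact ⟨1, one_pos, fun z β t _ _ _ _ _ _ => by simp [hw]⟩
  have hA' := abs_pos.2 hA
  have hB' := abs_pos.2 hB
  have hw' := abs_pos.2 hw
  -- C bounds |β| / |t|. K collects the coefficients of ε|t| in the error terms `b1` to `b4`, so ε K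
  -- < 2|w||B| keeps the errors below the main term; ε ≤ |A|/4 absorbs the error in z².
  set C := 4 / |A| * (|B| + 1) with hC
  have hCpos : 0 < C := by positivity
  set K := 2 * |w| * (C + 1) + |A| * |B| + |A| * C + |A| with hK
  have hKpos : 0 < K := by positivity
  obtain ⟨ε, hε, hε1, hεA, hεK⟩ : ∃ ε > 0, ε ≤ 1 ∧ ε ≤ |A| / 4 ∧ ε * K < 2 * |w| * |B| := by
    refine ⟨min (min 1 (|A| / 4)) (|w| * |B| / K), by positivity,
      (min_le_left _ _).trans (min_le_left _ _), (min_le_left _ _).trans (min_le_right _ _), ?_⟩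
    calc _ ≤ |w| * |B| / K * K := by gcongr; exact min_le_right _ _
      _ = |w| * |B| := by field_simp
      _ < _ := by nlinarith [mul_pos hw' hB']
  obtain ⟨δ₁, hδ₁, h1⟩ := exists_strict_bound (hasStrictFDerivAt_zero hV.1.1) hε
  obtain ⟨δ₂, hδ₂, h2⟩ := exists_quadratic_bound hV hε
  refine ⟨min ε (min δ₁ δ₂), by positivity, fun z β t hz hβ ht hβ0 fβ fz => ?_⟩
  simp only [lt_min_iff] at hz hβ ht
  obtain ⟨hzε, hz1, hz2⟩ := hz
  obtain ⟨-, hβ1, hβ2⟩ := hβ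
  obtain ⟨-, ht1, ht2⟩ := ht
  have qβ := h2 β t hβ2 ht2
  have qz := h2 z t hz2 ht2
  have hβ' := abs_pos.2 hβ0
  -- The leading order of the nonzero equilibrium.
  have bβ : |A * β / 2 + B * t| ≤ ε * (|β| + |t|) := by
    refine le_of_mul_le_mul_right ?_ hβ'
    rw [← abs_mul]
    rw [fβ, zero_sub, abs_neg] at qβ
    rwa [show (A * β / 2 + B * t) * β = A / 2 * β ^ 2 + B * t * β by ring]
  have bβt : |β| ≤ C * |t| := by
    have h3 : |A * β / 2| ≤ |A * β / 2 + B * t| + |B * t| := by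
      simpa using abs_sub (A * β / 2 + B * t) (B * t)
    have h4 : |A * β / 2| = |A| * |β| / 2 := by rw [abs_div, abs_mul]; simp
    rw [h4, abs_mul] at h3
    have h5 : ε * |β| ≤ |A| / 4 * |β| := by gcongr
    have h6 : ε * |t| ≤ |t| := mul_le_of_le_one_left (abs_nonneg _) hε1
    rw [hC, div_mul_eq_mul_div, div_mul_eq_mul_div, le_div_iff₀ hA']
    linarith
  -- The contribution of the inputs.
  have bin : |f (z, 0, t) + w * β| ≤ ε * |β| := by
    have h3 := h1 (z, fun i => if i ∈ S then β else 0, t) (z, 0, t)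
      (norm_internal _ _ _ _ hz1 (fun i => by split_ifs <;> simpa) ht1)
      (norm_internal _ _ _ _ hz1 (fun _ => by simpa using hδ₁) ht1)
    have e : ((z, fun i => if i ∈ S then β else 0, t) : Vars k) - (z, 0, t)
        = (0, fun i => if i ∈ S then β else 0, 0) := by
      ext <;> simp
    have en : ‖((0, fun i => if i ∈ S then β else 0, 0) : Vars k)‖ ≤ |β| := by
      simp only [Prod.norm_def, norm_zero, sup_le_iff, abs_nonneg, true_and, and_true]
      exact (pi_norm_le_iff_of_nonneg (abs_nonneg _)).2 fun i => by split_ifs <;> simp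
    rw [e, fz, fderiv_inputs] at h3
    have es : ∑ i, inputDeriv f i * (if i ∈ S then β else 0) = w * β := by
      simp [hwd, Finset.sum_mul]
    rw [es, zero_sub, ← neg_add', norm_neg, Real.norm_eq_abs] at h3
    exact h3.trans (by gcongr)
  by_contra! hneg
  have et : w * B * t = -(|w| * |B| * |t|) := by
    rw [← abs_mul, ← abs_mul, abs_of_neg hneg, neg_neg]
  have ht0 : 0 < |t| := abs_pos.2 (by rintro rfl; simp at hneg)
  set r := f (z, 0, t) - (A / 2 * z ^ 2 + B * t * z) with hr
  set p := f (z, 0, t) + w * β with hp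
  set q := A * β / 2 + B * t with hq
  -- Obtained by eliminating f(z, 0, t) and β. The left side is nonnegative while the main term 2wBt
  -- is negative; everything else is an error, A B t z included because |z| < ε.
  have ident : A ^ 2 / 2 * z ^ 2 = 2 * (w * B * t) + A * p - A * r - 2 * w * q - A * (B * t * z) := by
    rw [hr, hp, hq]; ring
  have b1 : A * p ≤ |A| * (ε * (C * |t|)) := by
    refine (le_abs_self _).trans ?_
    rw [abs_mul]
    gcongr
    exact bin.trans (by gcongr)
  have b2 : -(A * r) ≤ |A| * (ε * z ^ 2 + ε * |t|) := by
    refine (neg_le_abs _).trans ?_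
    rw [abs_mul]
    gcongr
    refine qz.trans ?_
    have h3 : |z| * |z| = z ^ 2 := by rw [abs_mul_abs_self]; ring
    have h4 : |t| * |z| ≤ |t| := mul_le_of_le_one_right ht0.le (hzε.le.trans hε1)
    calc ε * (|z| + |t|) * |z| = ε * (|z| * |z|) + ε * (|t| * |z|) := by ring
      _ ≤ ε * z ^ 2 + ε * |t| := by rw [h3]; gcongr
  have b3 : -(2 * w * q) ≤ 2 * |w| * (ε * (C * |t| + |t|)) := by
    refine (neg_le_abs _).trans ?_
    rw [abs_mul, abs_mul, abs_two]
    gcongr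
    exact bβ.trans (by gcongr)
  have b4 : -(A * (B * t * z)) ≤ |A| * (|B| * |t| * ε) := by
    refine (neg_le_abs _).trans ?_
    rw [abs_mul, abs_mul, abs_mul]
    gcongr
  have b5 : |A| * (ε * z ^ 2) ≤ A ^ 2 / 4 * z ^ 2 :=
    calc |A| * (ε * z ^ 2) ≤ |A| * (|A| / 4 * z ^ 2) := by gcongr
      _ = |A| * |A| / 4 * z ^ 2 := by ring
      _ = _ := by rw [abs_mul_abs_self, sq A]
  have b6 : 0 ≤ A ^ 2 / 4 * z ^ 2 := by positivity
  have b7 : ε * K * |t| < 2 * |w| * |B| * |t| := by gcongr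
  rw [hK] at b7
  clear_value p q r C K A B w
  rw [et] at ident
  linarith

end LocalAnalysis

/-! ### Genericity of the nondegeneracy conditions -/

section Genericity

variable {k : ℕ}

lemma abs_fderiv_sub_le {E : Type*} [NormedAddCommGroup E] [NormedSpace ℝ E] (f g : E → ℝ)
    (x v : E) (hv : ‖v‖ ≤ 1) :
    |fderiv ℝ g x v - fderiv ℝ f x v| ≤ ‖iteratedFDeriv ℝ 1 g x - iteratedFDeriv ℝ 1 f x‖ := by
  have h := (iteratedFDeriv ℝ 1 g x - iteratedFDeriv ℝ 1 f x).le_opNorm ![v]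
  simp only [sub_apply, iteratedFDeriv_one_apply, Fin.prod_univ_one,
    Matrix.cons_val_zero] at h
  exact h.trans (mul_le_of_le_one_right (norm_nonneg _) hv)

lemma abs_fderiv_fderiv_sub_le {E : Type*} [NormedAddCommGroup E] [NormedSpace ℝ E] (f g : E → ℝ)
    (x v w : E) (hv : ‖v‖ ≤ 1) (hw : ‖w‖ ≤ 1) :
    |fderiv ℝ (fderiv ℝ g) x v w - fderiv ℝ (fderiv ℝ f) x v w| ≤
      ‖iteratedFDeriv ℝ 2 g x - iteratedFDeriv ℝ 2 f x‖ := by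
  have h := (iteratedFDeriv ℝ 2 g x - iteratedFDeriv ℝ 2 f x).le_opNorm ![v, w]
  simp only [sub_apply, iteratedFDeriv_two_apply, Fin.prod_univ_two,
    Matrix.cons_val_zero, Matrix.cons_val_one] at h
  exact h.trans (mul_le_of_le_one_right (norm_nonneg _)
    (mul_le_one₀ hv (norm_nonneg _) hw))

lemma ne_zero_of_abs_sub_lt {a b : ℝ} (h : |b - a| < |a|) : b ≠ 0 := by
  rintro rfl
  simp at h

/-- The conditions are nonvanishing conditions on the 2-jet at the origin, so K = {0} and r = 2
suffice. -/
lemma nondegenerate_isOpen {f : Vars k → ℝ} (hf : f ∈ nondegenerate k) :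
    ∃ K : Set (Vars k), IsCompact K ∧ ∃ r : ℕ, ∃ ε > (0 : ℝ), ∀ g ∈ V0 k,
      (∀ x ∈ K, ∀ j ≤ r, ‖iteratedFDeriv ℝ j g x - iteratedFDeriv ℝ j f x‖ < ε) →
        g ∈ nondegenerate k := by
  obtain ⟨-, hA, hB, hS⟩ := hf
  have n1 : ‖((0, 0, 1) : Vars k)‖ ≤ 1 := by simp [Prod.norm_def]
  have n2 : ‖((0, 1, 0) : Vars k)‖ ≤ 1 := by
    simp only [Prod.norm_def, norm_zero, sup_le_iff, zero_le_one, true_and, and_true]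
    exact (pi_norm_le_iff_of_nonneg zero_le_one).2 (by simp)
  obtain ⟨η, hη, hηS⟩ : ∃ η > 0, k ≠ 0 → η ≤ |inputSum f| := by
    by_cases hk : k = 0
    · exact ⟨1, one_pos, fun h => (h hk).elim⟩
    · exact ⟨_, abs_pos.2 (hS hk), fun _ => le_rfl⟩
  refine ⟨{0}, isCompact_singleton, 2, min η (min |internalDeriv₂ f| |mixedDeriv f|),
    lt_min hη (lt_min (abs_pos.2 hA) (abs_pos.2 hB)), fun g hg h => ?_⟩
  have h1 := h 0 rfl 1 (by norm_num)
  have h2 := h 0 rfl 2 le_rfl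
  simp only [lt_min_iff] at h1 h2
  exact ⟨hg,
    ne_zero_of_abs_sub_lt ((abs_fderiv_fderiv_sub_le f g 0 _ _ norm_internal_unit
      norm_internal_unit).trans_lt h2.2.1),
    ne_zero_of_abs_sub_lt ((abs_fderiv_fderiv_sub_le f g 0 _ _ n1
      norm_internal_unit).trans_lt h2.2.2),
    fun hk => ne_zero_of_abs_sub_lt ((abs_fderiv_sub_le f g 0 _ n2).trans_lt
      (h1.1.trans_le (hηS hk)))⟩

/-- The polynomial `x₀² + x₀λ + ∑ᵢ xᵢ`. -/
def unfolding (k : ℕ) (p : Vars k) : ℝ := p.1 ^ 2 + p.1 * p.2.2 + ∑ i, p.2.1 i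

lemma unfolding_contDiff : ContDiff ℝ ∞ (unfolding k) := by
  unfold unfolding
  fun_prop

/-- The derivative of `unfolding`. -/
noncomputable def unfoldingDeriv (k : ℕ) (p : Vars k) : Vars k →L[ℝ] ℝ :=
  (2 * p.1 + p.2.2) • ContinuousLinearMap.fst ℝ ℝ ((Fin k → ℝ) × ℝ) +
    p.1 • (ContinuousLinearMap.snd ℝ (Fin k → ℝ) ℝ ∘L ContinuousLinearMap.snd ℝ ℝ _) +
    ∑ i, ContinuousLinearMap.proj (R := ℝ) (φ := fun _ : Fin k => ℝ) i ∘L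
      ContinuousLinearMap.fst ℝ (Fin k → ℝ) ℝ ∘L ContinuousLinearMap.snd ℝ ℝ _

lemma hasFDerivAt_unfolding (p : Vars k) :
    HasFDerivAt (unfolding k) (unfoldingDeriv k p) p := by
  have h1 : HasFDerivAt (fun p : Vars k => p.1) (ContinuousLinearMap.fst ℝ ℝ _) p :=
    hasFDerivAt_fst
  have h2 : HasFDerivAt (fun p : Vars k => p.2.2)
      (ContinuousLinearMap.snd ℝ (Fin k → ℝ) ℝ ∘L ContinuousLinearMap.snd ℝ ℝ _) p :=
    ContinuousLinearMap.hasFDerivAt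
      (ContinuousLinearMap.snd ℝ (Fin k → ℝ) ℝ ∘L ContinuousLinearMap.snd ℝ ℝ _)
  have h3 : ∀ i, HasFDerivAt (fun p : Vars k => p.2.1 i)
      (ContinuousLinearMap.proj (R := ℝ) (φ := fun _ : Fin k => ℝ) i ∘L
      ContinuousLinearMap.fst ℝ (Fin k → ℝ) ℝ ∘L ContinuousLinearMap.snd ℝ ℝ _) p :=
    fun i => ContinuousLinearMap.hasFDerivAt
      (ContinuousLinearMap.proj (R := ℝ) (φ := fun _ : Fin k => ℝ) i ∘L
      ContinuousLinearMap.fst ℝ (Fin k → ℝ) ℝ ∘L ContinuousLinearMap.snd ℝ ℝ _)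
  have h := ((h1.pow 2).add (h1.mul h2)).add (HasFDerivAt.fun_sum
    fun i (_ : i ∈ Finset.univ) => h3 i)
  refine HasFDerivAt.congr_fderiv h ?_
  rw [unfoldingDeriv, pow_one, add_smul, nsmul_eq_mul]
  push_cast
  abel

lemma fderiv_unfolding : fderiv ℝ (unfolding k) = unfoldingDeriv k :=
  funext fun p => (hasFDerivAt_unfolding p).fderiv

lemma fderiv_fderiv_unfolding (v w : Vars k) :
    fderiv ℝ (fderiv ℝ (unfolding k)) 0 v w = (2 * v.1 + v.2.2) * w.1 + v.1 * w.2.2 := by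
  have hd : DifferentiableAt ℝ (fderiv ℝ (unfolding k)) 0 :=
    (contDiff_fderiv unfolding_contDiff).differentiable (by simp) _
  have h1 := hd.hasFDerivAt.clm_apply (hasFDerivAt_const w 0)
  -- For fixed w this function of p is affine, and its derivative is its linear part.
  have h2 : HasFDerivAt (fun p : Vars k => unfoldingDeriv k p w)
      ((w.1 * 2) • ContinuousLinearMap.fst ℝ ℝ ((Fin k → ℝ) × ℝ) +
        w.1 • (ContinuousLinearMap.snd ℝ (Fin k → ℝ) ℝ ∘L ContinuousLinearMap.snd ℝ ℝ _) +
        w.2.2 • ContinuousLinearMap.fst ℝ ℝ ((Fin k → ℝ) × ℝ)) 0 := by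
    have := ((ContinuousLinearMap.hasFDerivAt (x := (0 : Vars k))
      ((w.1 * 2) • ContinuousLinearMap.fst ℝ ℝ ((Fin k → ℝ) × ℝ) +
        w.1 • (ContinuousLinearMap.snd ℝ (Fin k → ℝ) ℝ ∘L ContinuousLinearMap.snd ℝ ℝ _) +
        w.2.2 • ContinuousLinearMap.fst ℝ ℝ ((Fin k → ℝ) × ℝ)))).add_const (∑ i, w.2.1 i)
    refine this.congr_of_eventuallyEq (Eventually.of_forall fun p => ?_)
    simp [unfoldingDeriv]
    ring
  rw [fderiv_unfolding] at h1 ⊢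
  have := congrArg (fun T : Vars k →L[ℝ] ℝ => T v) (h1.unique h2)
  simp at this
  rw [this]
  ring

/-- A compactly supported member of `V0 k` along which all nondegeneracy conditions move. -/
lemma exists_compact_unfolding (k : ℕ) : ∃ h : Vars k → ℝ, ContDiff ℝ ∞ h ∧ HasCompactSupport h ∧
    (∀ t, h (0, 0, t) = 0) ∧ h =ᶠ[𝓝 0] unfolding k := by
  let φ : ContDiffBump (0 : Vars k) := ⟨1, 2, one_pos, one_lt_two⟩
  refine ⟨fun p => φ p * unfolding k p, φ.contDiff.mul unfolding_contDiff,
    φ.hasCompactSupport.mul_right, fun t => by simp [unfolding], ?_⟩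
  filter_upwards [φ.eventuallyEq_one] with p hp
  simp [hp]

lemma exists_small_ne (T : Finset ℝ) {η : ℝ} (hη : 0 < η) : ∃ s, 0 < s ∧ s < η ∧ s ∉ T := by
  obtain ⟨s, hs, hsT⟩ := (Ioo_infinite hη).exists_notMem_finset T
  exact ⟨s, hs.1, hs.2, hsT⟩

/-- Adding s times the compactly supported unfolding shifts the three quantities by 2s, s and ks, so
all but finitely many small s > 0 work. -/
lemma nondegenerate_dense {f : Vars k → ℝ} (hf : f ∈ V0 k) (r : ℕ) (ε : Vars k → ℝ)
    (hε : Continuous ε) (hε0 : ∀ x, 0 < ε x) :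
    ∃ g ∈ nondegenerate k,
      ∀ x, ∀ j ≤ r, ‖iteratedFDeriv ℝ j g x - iteratedFDeriv ℝ j f x‖ < ε x := by
  obtain ⟨h, hs, hc, hz, he⟩ := exists_compact_unfolding k
  obtain ⟨ε₀, hε₀, hε₀'⟩ : ∃ ε₀ > 0, ∀ x ∈ tsupport h, ε₀ ≤ ε x := by
    rcases (tsupport h).eq_empty_or_nonempty with h0 | h0
    · exact ⟨1, one_pos, by simp [h0]⟩
    · obtain ⟨x, -, hx⟩ := hc.isCompact.exists_isMinOn h0 hε.continuousOn
      exact ⟨ε x, hε0 x, fun y hy => hx hy⟩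
  have hM : ∀ j : ℕ, ∃ M, ∀ x, ‖iteratedFDeriv ℝ j h x‖ ≤ M := fun j =>
    (hs.continuous_iteratedFDeriv (by exact_mod_cast le_top)).bounded_above_of_compact_support
      (hc.iteratedFDeriv j)
  choose M hM using hM
  set M' := ∑ j ∈ Finset.range (r + 1), |M j| + 1 with hM'
  have hM'pos : 0 < M' := by positivity
  have hM'b : ∀ j ≤ r, ∀ x, ‖iteratedFDeriv ℝ j h x‖ < M' := fun j hj x =>
    calc _ ≤ |M j| := (hM j x).trans (le_abs_self _)
      _ ≤ ∑ j ∈ Finset.range (r + 1), |M j| :=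
        Finset.single_le_sum (f := fun j => |M j|) (fun _ _ => abs_nonneg _)
          (Finset.mem_range.2 (by omega))
      _ < _ := lt_add_one _
  -- The excluded values are those at which a shifted quantity vanishes. For k = 0 the last one is 0
  -- by convention, which is harmless as s > 0.
  obtain ⟨s, hs0, hsη, hsT⟩ := exists_small_ne
    {-internalDeriv₂ f / 2, -mixedDeriv f, -inputSum f / k} (div_pos hε₀ hM'pos)
  simp only [Finset.mem_insert, Finset.mem_singleton, not_or] at hsT
  have hfd : ∀ x, fderiv ℝ (f + s • h) x = fderiv ℝ f x + s • fderiv ℝ h x := fun x => by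
    rw [fderiv_add (hf.1.1.differentiable (by simp) x)
      ((hs.differentiable (by simp) x).const_smul s),
      fderiv_const_smul (hs.differentiable (by simp) x)]
  have h1 : fderiv ℝ h 0 = unfoldingDeriv k 0 := by rw [he.fderiv_eq, fderiv_unfolding]
  have hfdd : ∀ v w, fderiv ℝ (fderiv ℝ (f + s • h)) 0 v w = fderiv ℝ (fderiv ℝ f) 0 v w
      + s * ((2 * v.1 + v.2.2) * w.1 + v.1 * w.2.2) := fun v w => by
    have e : fderiv ℝ (f + s • h) = fderiv ℝ f + s • fderiv ℝ h := funext hfd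
    rw [e, fderiv_add ((contDiff_fderiv hf.1.1).differentiable (by simp) _)
      (((contDiff_fderiv hs).differentiable (by simp) _).const_smul s),
      fderiv_const_smul ((contDiff_fderiv hs).differentiable (by simp) _),
      he.fderiv.fderiv_eq, ← fderiv_fderiv_unfolding]
    simp
  have hV : f + s • h ∈ V0 k := by
    refine ⟨⟨hf.1.1.add (contDiff_const.smul hs), fun t => by simp [hf.1.2 t, hz t]⟩, ?_⟩
    have h0 := hf.2
    unfold internalDeriv at h0 ⊢
    rw [hfd, add_apply, h0, h1]
    simp [unfoldingDeriv]
  refine ⟨f + s • h, ⟨hV, fun h0 => hsT.1 ?_, fun h0 => hsT.2.1 ?_, fun hk h0 => hsT.2.2 ?_⟩,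
    fun x j hj => ?_⟩
  · rw [internalDeriv₂, hfdd] at h0
    rw [internalDeriv₂]
    simp at h0
    linarith
  · rw [mixedDeriv, hfdd] at h0
    rw [mixedDeriv]
    simp at h0
    linarith
  · rw [inputSum, hfd, h1] at h0
    rw [inputSum]
    simp [unfoldingDeriv] at h0
    have : (k : ℝ) ≠ 0 := by exact_mod_cast hk
    rw [eq_div_iff this]
    linarith
  · have hj' : ((j : ℕ) : WithTop ℕ∞) ≤ ∞ := by exact_mod_cast le_top
    have hsm : ContDiffAt ℝ j (s • h) x := (hs.const_smul s).contDiffAt.of_le hj'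
    rw [iteratedFDeriv_add_apply (hf.1.1.contDiffAt.of_le hj') hsm,
      iteratedFDeriv_const_smul_apply (hs.contDiffAt.of_le hj'), add_sub_cancel_left, norm_smul,
      Real.norm_of_nonneg hs0.le]
    by_cases hx : x ∈ tsupport h
    · calc s * ‖iteratedFDeriv ℝ j h x‖ ≤ s * M' := by gcongr; exact (hM'b j hj x).le
        _ < ε₀ := (lt_div_iff₀ hM'pos).1 hsη
        _ ≤ ε x := hε₀' x hx
    · have : iteratedFDeriv ℝ j h x = 0 := by
        by_contra hne
        exact hx (support_iteratedFDeriv_subset j hne)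
      simpa [this] using hε0 x

lemma isGeneric_nondegenerate (k : ℕ) : IsGeneric (V0 k) (nondegenerate k) :=
  ⟨fun _ hf => hf.1, fun _ hf => nondegenerate_isOpen hf,
    fun _ hf r ε hε hε0 => nondegenerate_dense hf r ε hε hε0⟩

end Genericity

/-! ### Small equilibria on the first three layers -/

section Equilibria

variable {k n : ℕ} {C : Type*} {L : Network k C} {layer : C → ℕ} {f : Vars k → ℝ}

/-- Small equilibria at the cells of the first two layers. -/
lemma exists_radius_cells (hL : L.IsFeedForward n layer) (hf : f ∈ nondegenerate k) (hk : k ≠ 0) :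
    ∃ δ > 0, ∀ (x : C → ℝ) (t : ℝ), (∀ c, |x c| < δ) → |t| < δ → L.field f x t = 0 →
      (∀ c, layer c = 1 → f (x c, 0, t) = 0) ∧
      ∀ c c', layer c = 1 → layer c' = 1 → x c ≠ 0 → x c' ≠ 0 → x c = x c' := by
  obtain ⟨δ₀, hδ₀, h0⟩ := exists_radius_self_input hf hk
  obtain ⟨δ₁, hδ₁, h1⟩ := exists_radius_unique hf
  refine ⟨min δ₀ δ₁, by positivity, fun x t hx ht hxt => ?_⟩
  simp only [lt_min_iff] at hx ht
  have hxt : ∀ c, f (x c, fun i => x (L.src i c), t) = 0 := fun c => congrFun hxt c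
  have hl0 : ∀ c, layer c = 0 → x c = 0 := fun c hc => by
    refine h0 _ t (hx c).1 ht.1 ?_
    simpa [hL.first c hc] using hxt c
  have hl1 : ∀ c, layer c = 1 → f (x c, 0, t) = 0 := fun c hc => by
    have := hxt c
    rwa [show (fun i => x (L.src i c)) = 0 from funext fun i => hl0 _ (hL.step c 0 hc i)] at this
  exact ⟨hl1, fun c c' hc hc' =>
    h1 _ _ t (hx c).2 (hx c').2 ht.2 (hl1 c hc) (hl1 c' hc')⟩

/-- Near the bifurcation point, no equilibrium vanishes at a cell of the second layer and not at
another one, if cells of the third layer see the first one with weights of opposite signs. -/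
lemma exists_radius_no_switch (hL : L.IsFeedForward n layer) (hf : f ∈ nondegenerate k) {a a' : C}
    (ha : layer a = 1) (ha' : layer a' = 1)
    (hw : ∀ I : Set C, I ⊆ {c | layer c = 1} \ {a, a'} → ∃ d' d'', layer d' = 2 ∧ layer d'' = 2 ∧
      (L.weight f d' I + L.weight f d' {a}) * (L.weight f d'' I + L.weight f d'' {a}) < 0) :
    ∃ δ > 0, ∀ (x : C → ℝ) (t : ℝ), (∀ c, |x c| < δ) → |t| < δ → t ≠ 0 →
      L.field f x t = 0 → x a ≠ 0 → x a' ≠ 0 := by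
  classical
  have hk : k ≠ 0 := by
    rintro rfl
    obtain ⟨d', d'', -, -, h⟩ := hw ∅ (empty_subset _)
    simp [Network.weight] at h
  obtain ⟨δ₁, hδ₁, h1⟩ := exists_radius_cells hL hf hk
  choose δ₂ hδ₂ h2 using exists_radius_sign hf
  -- The set of edge types with nonzero source varies with x, but there are only finitely many such
  -- sets.
  obtain ⟨δ₃, hδ₃, h3⟩ : ∃ δ > 0, ∀ S, δ ≤ δ₂ S := by
    obtain ⟨S, hS⟩ := Finite.exists_min δ₂
    exact ⟨δ₂ S, hδ₂ S, hS⟩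
  refine ⟨min δ₁ δ₃, by positivity, fun x t hx ht ht0 hxt hxa hxa' => ?_⟩
  simp only [lt_min_iff] at hx ht
  obtain ⟨hl1, huniq⟩ := h1 x t (fun c => (hx c).1) ht.1 hxt
  have hxt : ∀ c, f (x c, fun i => x (L.src i c), t) = 0 := fun c => congrFun hxt c
  have hl1' : ∀ c, layer c = 1 → x c ≠ 0 → x c = x a := fun c hc hxc => huniq c a hc ha hxc hxa
  have sgn : ∀ d, layer d = 2 →
      0 ≤ (∑ i with x (L.src i d) ≠ 0, inputDeriv f i) * mixedDeriv f * t := fun d hd => by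
    refine h2 {i | x (L.src i d) ≠ 0} (x d) (x a) t ((hx d).2.trans_le (h3 _))
      ((hx a).2.trans_le (h3 _)) (ht.2.trans_le (h3 _)) hxa (hl1 a ha) ?_
    have := hxt d
    have e : (fun i => if i ∈ ({i | x (L.src i d) ≠ 0} : Finset (Fin k)) then x a else 0) =
        fun i => x (L.src i d) := funext fun i => by
      by_cases hi : x (L.src i d) = 0
      · simp [hi]
      · rw [if_pos (by simpa using hi), hl1' _ (hL.step d 1 hd i) hi]
    rwa [e]
  -- This set avoids a' because x a' = 0 is being assumed; with a added it is the whole nonzero part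
  -- of the second layer.
  set I : Set C := {c | layer c = 1 ∧ x c ≠ 0 ∧ c ≠ a} with hI
  obtain ⟨d', d'', hd', hd'', hneg⟩ := hw I (by
    rintro c ⟨hc1, hc2, hc3⟩
    refine ⟨hc1, ?_⟩
    rintro (rfl | rfl)
    · exact hc3 rfl
    · exact hc2 hxa')
  have hwt : ∀ d, layer d = 2 → L.weight f d I + L.weight f d {a} =
      ∑ i with x (L.src i d) ≠ 0, inputDeriv f i := fun d hd => by
    simp only [Network.weight, Finset.sum_filter, ← Finset.sum_add_distrib]
    refine Finset.sum_congr rfl fun i _ => ?_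
    have h4 := hL.step d 1 hd i
    by_cases hia : L.src i d = a
    · simp [hI, hia, hxa]
    · by_cases hi : x (L.src i d) = 0 <;> simp [hI, hia, hi, h4]
  rw [hwt _ hd', hwt _ hd''] at hneg
  have e1 := sgn d' hd'
  have e2 := sgn d'' hd''
  have hB : mixedDeriv f ≠ 0 := hf.2.2.1
  -- The product of `e1` and `e2` is the product of the two weights times this square, so the
  -- weights cannot have opposite signs.
  have : 0 < (mixedDeriv f * t) ^ 2 := by positivity
  nlinarith [mul_nonneg e1 e2]

/-- Near the bifurcation point, equilibria agree at two cells of the second layer that are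
distinguished by weights of opposite signs. -/
lemma exists_radius_eq (hL : L.IsFeedForward n layer) (hf : f ∈ nondegenerate k) {a a' : C}
    (ha : layer a = 1) (ha' : layer a' = 1)
    (hw : ∀ I : Set C, I ⊆ {c | layer c = 1} \ {a, a'} → ∃ d' d'', layer d' = 2 ∧ layer d'' = 2 ∧
      (L.weight f d' I + L.weight f d' {a}) * (L.weight f d'' I + L.weight f d'' {a}) < 0 ∧
      (L.weight f d' I + L.weight f d' {a'}) * (L.weight f d'' I + L.weight f d'' {a'}) < 0) :
    ∃ δ > 0, ∀ (x : C → ℝ) (t : ℝ), (∀ c, |x c| < δ) → |t| < δ → t ≠ 0 →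
      L.field f x t = 0 → x a = x a' := by
  obtain ⟨δ₁, hδ₁, h1⟩ := exists_radius_no_switch hL hf ha ha' fun I hI => by
    obtain ⟨d', d'', h, h', hw, -⟩ := hw I hI
    exact ⟨d', d'', h, h', hw⟩
  obtain ⟨δ₂, hδ₂, h2⟩ := exists_radius_no_switch hL hf ha' ha fun I hI => by
    obtain ⟨d', d'', h, h', -, hw⟩ := hw I (by rwa [pair_comm])
    exact ⟨d', d'', h, h', hw⟩
  have hk : k ≠ 0 := by
    rintro rfl
    obtain ⟨d', d'', -, -, h, -⟩ := hw ∅ (empty_subset _)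
    simp [Network.weight] at h
  obtain ⟨δ₃, hδ₃, h3⟩ := exists_radius_cells hL hf hk
  refine ⟨min δ₁ (min δ₂ δ₃), by positivity, fun x t hx ht ht0 hxt => ?_⟩
  simp only [lt_min_iff] at hx ht
  by_cases hxa : x a = 0
  · by_cases hxa' : x a' = 0
    · rw [hxa, hxa']
    · exact (h2 x t (fun c => (hx c).2.1) ht.2.1 ht0 hxt hxa' hxa).elim
  · exact (h3 x t (fun c => (hx c).2.2) ht.2.2 hxt).2 a a' ha ha' hxa
      (h1 x t (fun c => (hx c).1) ht.1 ht0 hxt hxa)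

/-- Bifurcation branches are lifted as soon as they agree on the two halves of the split cell. -/
lemma isLiftedFrom_of_isSplit {CN : Type*} {N : Network k CN} {c : CN} {a a' : C}
    (hs : N.IsSplit L c a a') {D : Set ℝ} {b : ℝ → C → ℝ} (hb : ∀ᶠ t in 𝓝[D] 0, b t a = b t a') :
    IsLiftedFrom N L D b := by
  obtain ⟨-, h, φ, hφ, -⟩ := hs
  refine ⟨pairColoring a a', h, ⟨φ, hφ⟩, ?_⟩
  filter_upwards [hb] with t ht
  rintro x y (rfl | ⟨rfl | rfl, rfl | rfl⟩)
  · rfl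
  · rfl
  · exact ht
  · exact ht.symm
  · rfl

end Equilibria

end FFN

/-! ### From pointwise equilibria to germs of branches -/

theorem mainTheorem11 (k : ℕ) :
    ∃ G : Set (FFN.Vars k → ℝ), FFN.IsGeneric (FFN.V0 k) G ∧
      ∀ (CN : Type*) (CL : Type*) [Finite CN] [Finite CL]
        (N : FFN.Network k CN) (L : FFN.Network k CL)
        (m n : ℕ) (layerN : CN → ℕ) (layerL : CL → ℕ)
        (_ : N.IsFeedForward m layerN) (_ : L.IsFeedForward n layerL)
        (c : CN) (c₁ c₂ : CL)
        (_ : layerN c = 1) (_ : layerL c₁ = 1) (_ : layerL c₂ = 1)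
        (_ : N.IsSplit L c c₁ c₂),
        ∀ f ∈ G,
          (∀ I : Set CL, I ⊆ {a | layerL a = 1} \ {c₁, c₂} →
            ∃ d' d'' : CL, layerL d' = 2 ∧ layerL d'' = 2 ∧
              (L.weight f d' I + L.weight f d' {c₁}) *
                (L.weight f d'' I + L.weight f d'' {c₁}) < 0 ∧
              (L.weight f d' I + L.weight f d' {c₂}) *
                (L.weight f d'' I + L.weight f d'' {c₂}) < 0) →
          ∀ (D : Set ℝ) (b : ℝ → CL → ℝ),
            L.IsBifurcationBranch f D b → FFN.IsLiftedFrom N L D b := by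
  refine ⟨FFN.nondegenerate k, FFN.isGeneric_nondegenerate k, ?_⟩
  intro CN CL _ _ N L m n layerN layerL _ hL c c₁ c₂ _ h₁ h₂ hs f hf hw D b hb
  obtain ⟨δ, hδ, h⟩ := FFN.exists_radius_eq hL hf h₁ h₂ hw
  refine FFN.isLiftedFrom_of_isSplit hs ?_
  obtain ⟨⟨hD, hcont, hz, heq⟩, -⟩ := hb
  have h0 : (0 : ℝ) ∈ D := by
    obtain ⟨l, hl, rfl | rfl | rfl⟩ := hD <;> simp [hl]
  have hsmall : ∀ᶠ t in 𝓝[D] (0 : ℝ), ∀ a, |b t a| < δ := by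
    refine eventually_all.2 fun a => ?_
    have ht : Tendsto (fun t => |b t a|) (𝓝[D] 0) (𝓝 |b 0 a|) :=
      ((continuous_apply a).continuousAt.tendsto.comp (hcont 0 h0)).abs
    rw [hz] at ht
    exact ht.eventually_lt_const (by simpa using hδ)
  have htsmall : ∀ᶠ t in 𝓝[D] (0 : ℝ), |t| < δ := by
    refine nhdsWithin_le_nhds ?_
    filter_upwards [Metric.ball_mem_nhds (0 : ℝ) hδ] with t ht
    simpa using ht
  filter_upwards [hsmall, htsmall, self_mem_nhdsWithin] with t h1 h2 h3
  -- The sign argument needs t ≠ 0; at t = 0 the branch is at the origin.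
  by_cases ht : t = 0
  · simp [ht, hz]
  · exact h (b t) t h1 h2 ht (heq t h3)
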